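/- Let $(M,J)$ be an almost complex manifold: a $C^\infty$ manifold of real dimension $2n$ with a smooth field $J$ of endomorphisms of the tangent spaces such that $J^2=-1$. A function $f:U\to\mathbb{C}$ on an open set $U\subset M$ is called almost holomorphic if it is smooth and $J^*df=i\,df$, where $(J^*\omega)(X)=\omega(JX)$. Smooth functions $g_1,\dots,g_k:U\to\mathbb{C}$ are called functionally independent on $U$ if $d_pg_1,\dots,d_pg_k$ are linearly independent over $\mathbb{C}$ at every point $p\in U$, and functionally dependent on $U$ if these differentials are linearly dependent over $\mathbb{C}$ at every point $p\in U$. A local Spencer coordinate system of type $m$ (where $m\le n$) consists of an open set $U\subset M$ and almost holomorphic functions $f_1,\dots,f_m:U\to\mathbb{C}$ such that 1. $f_1,\dots,f_m$ are functionally independent on $U$; 2. the sequence is maximal: for every almost holomorphic function $g$ on $U$, the functions $f_1,\dots,f_m,g$ are functionally dependent on $U$; 3. $f_1,\dots,f_m$ are the first $m$ members of a system of complex coordinates $(w^1,\dots,w^m,z^{m+1},\dots,z^n)$ on $U$, that is, of a diffeomorphism of $U$ onto an open subset of $\mathbb{C}^n$ (regarded as a real manifold). Put $f_U=(f_1,\dots,f_m):U\to\mathbb{C}^m$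 and $U_m^c=f_U(U)$, and suppose that the leaves $f_U^{-1}(w)\subset U$, $w\in U_m^c$, are connected. Then $U_m^c$ is open in $\mathbb{C}^m$, and for every almost holomorphic function $h:U\to\mathbb{C}$ there is a holomorphic function $H:U_m^c\to\mathbb{C}$ such that $$h=H\circ(f_1,\dots,f_m)=H(f_1,\dots,f_m)\quad\text{on } U.$$ -/

import Mathlib

open scoped Manifold ContDiff

noncomputable section

namespace Spencer

/-- The model space `ℝ^{2n}` of a real `2n`-dimensional manifold. -/
abbrev Model (n : ℕ) : Type := EuclideanSpace ℝ (Fin (2 * n))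

section

variable (n : ℕ) (M : Type*) [TopologicalSpace M] [ChartedSpace (Model n) M]
  [IsManifold 𝓘(ℝ, Model n) ∞ M]

/-- An almost complex structure on the smooth `2n`-dimensional manifold `M`: a `C^∞` field of
endomorphisms `J_p` of the real tangent spaces with `J_p ∘ J_p = -1`. -/
structure AlmostComplexStructure where
  /-- The endomorphism of the tangent space at each point. -/
  J : ∀ p : M, TangentSpace 𝓘(ℝ, Model n) p →L[ℝ] TangentSpace 𝓘(ℝ, Model n) p
  sq_eq_neg : ∀ (p : M) (v : TangentSpace 𝓘(ℝ, Model n) p), J p (J p v) = -v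
  smooth : ContMDiff 𝓘(ℝ, Model n)
    (𝓘(ℝ, Model n).prod 𝓘(ℝ, Model n →L[ℝ] Model n)) ∞
    (fun p : M ↦ Bundle.TotalSpace.mk' (Model n →L[ℝ] Model n)
      (E := fun p : M ↦
        TangentSpace 𝓘(ℝ, Model n) p →L[ℝ] TangentSpace 𝓘(ℝ, Model n) p) p (J p))

end

variable {n : ℕ} {M : Type*} [TopologicalSpace M] [ChartedSpace (Model n) M]

/-- The differential `d_p f` of a complex-valued function, as an `ℝ`-linear form on the tangent
space with values in `ℂ`. These forms make up a vector space over `ℂ`. -/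
def cdiff (f : M → ℂ) (p : M) : TangentSpace 𝓘(ℝ, Model n) p →L[ℝ] ℂ :=
  mfderiv 𝓘(ℝ, Model n) 𝓘(ℝ, ℂ) f p

/-- The functions `f_j` are functionally independent on `U`: at each point of `U` their
differentials are linearly independent over `ℂ`. -/
def FunctionallyIndependentOn {k : ℕ} (f : Fin k → M → ℂ) (U : Set M) : Prop :=
  ∀ p ∈ U, LinearIndependent ℂ (fun j ↦ cdiff (n := n) (f j) p)

/-- The functions `f_j` are functionally dependent on `U`: at each point of `U` their
differentials are linearly dependent over `ℂ` (so they are functionally independent on no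
nonempty part of `U`). -/
def FunctionallyDependentOn {k : ℕ} (f : Fin k → M → ℂ) (U : Set M) : Prop :=
  ∀ p ∈ U, ¬ LinearIndependent ℂ (fun j ↦ cdiff (n := n) (f j) p)

variable [IsManifold 𝓘(ℝ, Model n) ∞ M]

/-- `f` is almost holomorphic on the open set `U`: it is smooth there and `J^* df = i df`, where
`(J^* ω) v = ω (J v)`. Only the values of `f` on `U` matter. -/
def AlmostHolomorphicOn (𝒥 : AlmostComplexStructure n M) (f : M → ℂ) (U : Set M) : Prop :=
  ContMDiffOn 𝓘(ℝ, Model n) 𝓘(ℝ, ℂ) ∞ f U ∧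
    ∀ p ∈ U, (cdiff (n := n) f p).comp (𝒥.J p) = Complex.I • cdiff (n := n) f p

/-- A local Spencer coordinate system of type `m` on the almost complex manifold `(M, J)`. -/
structure LocalSpencerCoordinates (𝒥 : AlmostComplexStructure n M) (m : ℕ) where
  /-- The domain. -/
  U : Set M
  isOpen_U : IsOpen U
  /-- The functions `f_1, …, f_m`. -/
  f : Fin m → M → ℂ
  almostHolomorphic : ∀ j, AlmostHolomorphicOn 𝒥 (f j) U
  independent : FunctionallyIndependentOn (n := n) f U
  /-- Maximality: no almost holomorphic function on `U` can be adjoined. -/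
  maximal : ∀ g : M → ℂ, AlmostHolomorphicOn 𝒥 g U →
    FunctionallyDependentOn (n := n) (Fin.snoc (α := fun _ ↦ M → ℂ) f g) U
  le : m ≤ n
  /-- The complex coordinates `(w^1, …, w^m, z^{m+1}, …, z^n)`, which together with their
  conjugates form the self-conjugate coordinate system: a diffeomorphism of `U` onto an open
  subset of `ℂ^n`, regarded as a real manifold. -/
  coord : PartialDiffeomorph 𝓘(ℝ, Model n) 𝓘(ℝ, Fin n → ℂ) M (Fin n → ℂ) ∞
  source_eq : coord.source = U
  coord_eq : ∀ p ∈ U, ∀ j : Fin m, coord p (Fin.castLE le j) = f j p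

namespace LocalSpencerCoordinates

variable {𝒥 : AlmostComplexStructure n M} {m : ℕ}

/-- The mapping `f_U = (f_1, …, f_m)`. -/
def map (S : LocalSpencerCoordinates 𝒥 m) (p : M) : Fin m → ℂ := fun j ↦ S.f j p

/-- The associated set `U_m^c = f_U(U)` in `ℂ^m`. -/
def image (S : LocalSpencerCoordinates 𝒥 m) : Set (Fin m → ℂ) := S.map '' S.U

/-- The leaf of `f_U` over `w`: the set of the points of `U` that `f_U` sends to `w`. -/
def leaf (S : LocalSpencerCoordinates 𝒥 m) (w : Fin m → ℂ) : Set M := {p ∈ S.U | S.map p = w}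

end LocalSpencerCoordinates

end Spencer

end

namespace Spencer

open Set Filter Topology

/-! By maximality, `dh` is at every point of `U` a complex combination of the independent forms
`df_j`. Hence in the coordinates `(w, z)` the derivative of `h` is `∑ c_j dw^j`, which is complex
linear and vanishes in the `z` directions. The vanishing makes `h` locally constant on each leaf, so
constant there by connectedness, and `h` factors as `H ∘ f_U`. The complex linearity makes `H`
holomorphic: near each point of the image, `H` is `h` read along an affine slice `z = const`. -/

/-- Extension by zero `ℂ^m → ℂ^n` onto the first `m` coordinates. -/
noncomputable def extendByZero (m n : ℕ) : (Fin m → ℂ) →L[ℂ] (Fin n → ℂ) :=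
  ContinuousLinearMap.pi fun i ↦
    if hi : (i : ℕ) < m then ContinuousLinearMap.proj (R := ℂ) (φ := fun _ : Fin m ↦ ℂ) ⟨i, hi⟩
    else 0

lemma extendByZero_castLE {m n : ℕ} (h : m ≤ n) (w : Fin m → ℂ) (j : Fin m) :
    extendByZero m n w (Fin.castLE h j) = w j := by
  simp [extendByZero]

/-- A function on a convex set whose derivatives at each point factor through the first `m`
coordinates is determined by these coordinates. -/
lemma eq_of_hasFDerivAt_of_convex {m n : ℕ} (hmn : m ≤ n) {V : Set (Fin n → ℂ)}
    (hV : Convex ℝ V) {g : (Fin n → ℂ) → ℂ}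
    (hg : ∀ x ∈ V, ∃ c : Fin m → ℂ, HasFDerivAt g
      (∑ j, c j • ContinuousLinearMap.proj (R := ℂ) (φ := fun _ : Fin n ↦ ℂ) (Fin.castLE hmn j)) x)
    {x y : Fin n → ℂ} (hx : x ∈ V) (hy : y ∈ V)
    (hxy : ∀ j : Fin m, x (Fin.castLE hmn j) = y (Fin.castLE hmn j)) : g x = g y := by
  -- The velocity `y - x` of the segment has zero first `m` coordinates, so each form `∑ c_j dw^j`
  -- kills it.
  have key : ∀ t ∈ Icc (0 : ℝ) 1,
      HasDerivAt (fun t : ℝ ↦ g (AffineMap.lineMap x y t)) 0 t := by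
    intro t ht
    obtain ⟨c, hc⟩ := hg _ (hV.lineMap_mem hx hy ht)
    have := (hc.restrictScalars ℝ).comp_hasDerivAt t
      (AffineMap.hasDerivAt_lineMap (a := x) (b := y) (x := t))
    simpa [sum_apply, hxy, Function.comp_def] using this
  have := constant_of_has_deriv_right_zero
    (fun t ht ↦ (key t ht).continuousAt.continuousWithinAt)
    (fun t ht ↦ (key t (Ico_subset_Icc_self ht)).hasDerivWithinAt) 1 (by simp)
  simpa using this.symm

namespace LocalSpencerCoordinates

variable {n m : ℕ} {M : Type*} [TopologicalSpace M] [ChartedSpace (Model n) M]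
  [IsManifold 𝓘(ℝ, Model n) ∞ M] {𝒥 : AlmostComplexStructure n M}
  (S : LocalSpencerCoordinates 𝒥 m)

/-- If `dh` were outside the span at a single point, adjoining it would keep the family independent
there, whereas maximality demands dependence at every point. -/
lemma cdiff_mem_span {h : M → ℂ} (hh : AlmostHolomorphicOn 𝒥 h S.U) {p : M} (hp : p ∈ S.U) :
    cdiff (n := n) h p ∈ Submodule.span ℂ (range fun j ↦ cdiff (n := n) (S.f j) p) := by
  by_contra hnot
  apply S.maximal h hh p hp
  have : (fun j ↦ cdiff (n := n) (Fin.snoc (α := fun _ ↦ M → ℂ) S.f h j) p) =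
      Fin.snoc (α := fun _ ↦ TangentSpace 𝓘(ℝ, Model n) p →L[ℝ] ℂ)
        (fun j ↦ cdiff (n := n) (S.f j) p) (cdiff (n := n) h p) := by
    funext j
    refine Fin.lastCases ?_ (fun i ↦ ?_) j <;> simp
  rw [this]
  exact linearIndependent_finSnoc.2 ⟨S.independent p hp, hnot⟩

lemma symm_mem {x : Fin n → ℂ} (hx : x ∈ S.coord.target) : S.coord.symm x ∈ S.U := by
  rw [← S.source_eq]
  exact S.coord.toPartialEquiv.map_target hx

lemma coord_symm {x : Fin n → ℂ} (hx : x ∈ S.coord.target) : S.coord (S.coord.symm x) = x :=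
  S.coord.toPartialEquiv.right_inv hx

lemma coord_mem {p : M} (hp : p ∈ S.U) : S.coord p ∈ S.coord.target :=
  S.coord.toPartialEquiv.map_source (by rwa [S.source_eq])

lemma symm_coord {p : M} (hp : p ∈ S.U) : S.coord.symm (S.coord p) = p :=
  S.coord.toPartialEquiv.left_inv (by rw [← S.source_eq] at hp; exact hp)

lemma map_symm {x : Fin n → ℂ} (hx : x ∈ S.coord.target) (j : Fin m) :
    S.map (S.coord.symm x) j = x (Fin.castLE S.le j) := by
  rw [map, ← S.coord_eq _ (S.symm_mem hx), S.coord_symm hx]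

/-- In the complex coordinates, the differential of an almost holomorphic function is a complex
combination of `dw^1, …, dw^m`. -/
lemma hasFDerivAt_comp_symm {h : M → ℂ} (hh : AlmostHolomorphicOn 𝒥 h S.U) {x : Fin n → ℂ}
    (hx : x ∈ S.coord.target) :
    ∃ c : Fin m → ℂ, HasFDerivAt (h ∘ S.coord.symm)
      (∑ j, c j • ContinuousLinearMap.proj (R := ℂ) (φ := fun _ : Fin n ↦ ℂ)
        (Fin.castLE S.le j)) x := by
  have hp := S.symm_mem hx
  have hsymm : MDifferentiableAt 𝓘(ℝ, Fin n → ℂ) 𝓘(ℝ, Model n) S.coord.symm x :=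
    (S.coord.symm.contMDiffOn.contMDiffAt
      (S.coord.open_target.mem_nhds hx)).mdifferentiableAt (by simp)
  let D : (Fin n → ℂ) →L[ℝ] Model n := mfderiv 𝓘(ℝ, Fin n → ℂ) 𝓘(ℝ, Model n) S.coord.symm x
  let ℓ : (M → ℂ) → Model n →L[ℝ] ℂ := fun g ↦ cdiff (n := n) g (S.coord.symm x)
  have hderiv : ∀ g : M → ℂ, AlmostHolomorphicOn 𝒥 g S.U →
      HasFDerivAt (g ∘ S.coord.symm) ((ℓ g).comp D) x := by
    intro g hg
    have hg' : MDifferentiableAt 𝓘(ℝ, Model n) 𝓘(ℝ, ℂ) g (S.coord.symm x) :=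
      (hg.1.contMDiffAt (S.isOpen_U.mem_nhds hp)).mdifferentiableAt (by simp)
    exact (hg'.hasMFDerivAt.comp x hsymm.hasMFDerivAt).hasFDerivAt
  obtain ⟨c, hc⟩ := (Submodule.mem_span_range_iff_exists_fun ℂ).1 (S.cdiff_mem_span hh hp)
  have hℓ : ℓ h = ∑ j, c j • ℓ (S.f j) := hc.symm
  -- A real derivative that coincides with a complex-linear map is a complex derivative.
  refine ⟨c, hasFDerivAt_of_restrictScalars ℝ (hderiv h hh) ?_⟩
  -- In these coordinates `f_j` is the `j`-th coordinate function, so uniqueness of the derivative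
  -- gives `df_j = dw^j`.
  have hf : ∀ j v, ℓ (S.f j) (D v) = v (Fin.castLE S.le j) := by
    intro j v
    have h1 := hderiv (S.f j) (S.almostHolomorphic j)
    have h2 : HasFDerivAt (S.f j ∘ S.coord.symm)
        (ContinuousLinearMap.proj (R := ℝ) (φ := fun _ : Fin n ↦ ℂ) (Fin.castLE S.le j)) x := by
      refine (ContinuousLinearMap.hasFDerivAt _).congr_of_eventuallyEq ?_
      filter_upwards [S.coord.open_target.mem_nhds hx] with y hy
      exact S.map_symm hy j
    exact congrArg (fun L : (Fin n → ℂ) →L[ℝ] ℂ ↦ L v) (h1.unique h2)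
  refine ContinuousLinearMap.ext fun v ↦ ?_
  simp [hℓ, hf, sum_apply]

/-- An almost holomorphic function is constant on a connected leaf. -/
lemma eq_of_map_eq {h : M → ℂ} (hh : AlmostHolomorphicOn 𝒥 h S.U) {p q : M}
    (hp : p ∈ S.U) (hq : q ∈ S.U) (hpq : S.map p = S.map q)
    (hleaf : IsPreconnected (S.leaf (S.map q))) : h p = h q := by
  set L := S.leaf (S.map q)
  have hconst : IsLocallyConstant (fun a : L ↦ h a) := by
    rw [IsLocallyConstant.iff_eventually_eq]
    rintro ⟨a, ha⟩
    -- The target need not be convex, so segments are used only inside a ball; this yields local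
    -- constancy, and connectedness does the rest.
    obtain ⟨r, hr, hball⟩ := Metric.isOpen_iff.1 S.coord.open_target _ (S.coord_mem ha.1)
    have hcont : ContinuousAt S.coord a :=
      (S.coord.contMDiffOn.contMDiffAt (by
        rw [S.source_eq]; exact S.isOpen_U.mem_nhds ha.1)).continuousAt
    have hcont' : ContinuousAt (fun b : L ↦ S.coord b) ⟨a, ha⟩ :=
      ContinuousAt.comp (f := fun b : L ↦ (b : M)) hcont continuous_subtype_val.continuousAt
    filter_upwards [hcont'.preimage_mem_nhds (Metric.ball_mem_nhds _ hr)] with b hb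
    have hab : h (S.coord.symm (S.coord b)) = h (S.coord.symm (S.coord a)) :=
      eq_of_hasFDerivAt_of_convex S.le (convex_ball (S.coord a) r)
        (fun x hx ↦ S.hasFDerivAt_comp_symm hh (hball hx)) hb (Metric.mem_ball_self hr) fun j ↦
          ((S.coord_eq _ b.2.1 j).trans (congrFun (b.2.2.trans ha.2.symm) j)).trans
            (S.coord_eq _ ha.1 j).symm
    rwa [S.symm_coord b.2.1, S.symm_coord ha.1] at hab
  have := isPreconnected_iff_preconnectedSpace.1 hleaf
  exact hconst.apply_eq_of_preconnectedSpace ⟨p, hp, hpq⟩ ⟨q, hq, rfl⟩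

/-- The affine section `ℂ^m → ℂ^n` of the projection to the first `m` coordinates through the
image of `p` under the complex coordinates. -/
noncomputable def affineSection (p : M) (w : Fin m → ℂ) : Fin n → ℂ := S.coord p + extendByZero m n (w - S.map p)

lemma affineSection_map (p : M) : S.affineSection p (S.map p) = S.coord p := by
  simp [affineSection]

lemma hasFDerivAt_affineSection (p : M) (w : Fin m → ℂ) :
    HasFDerivAt (S.affineSection p) (extendByZero m n) w :=
  ((extendByZero m n).hasFDerivAt.comp w ((hasFDerivAt_id w).sub_const (S.map p))).const_add _

lemma eventually_affineSection_mem {p : M} (hp : p ∈ S.U) :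
    ∀ᶠ w in 𝓝 (S.map p), S.affineSection p w ∈ S.coord.target :=
  (S.hasFDerivAt_affineSection p _).continuousAt.preimage_mem_nhds
    (S.coord.open_target.mem_nhds (by rw [S.affineSection_map]; exact S.coord_mem hp))

lemma map_symm_affineSection {p : M} (hp : p ∈ S.U) {w : Fin m → ℂ}
    (hw : S.affineSection p w ∈ S.coord.target) :
    S.map (S.coord.symm (S.affineSection p w)) = w := by
  funext j
  rw [S.map_symm hw, affineSection, Pi.add_apply, extendByZero_castLE, S.coord_eq p hp]
  simp [map]

/-- The affine section followed by the inverse coordinates is a local right inverse of `f_U` near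
each image point. -/
lemma isOpen_image : IsOpen S.image := by
  rw [isOpen_iff_mem_nhds]
  rintro _ ⟨p, hp, rfl⟩
  filter_upwards [S.eventually_affineSection_mem hp] with w hw
  exact ⟨_, S.symm_mem hw, S.map_symm_affineSection hp hw⟩

/-- A function on `ℂ^m` through which an almost holomorphic function factors is holomorphic. -/
lemma differentiableOn_of_eq_comp {h : M → ℂ} (hh : AlmostHolomorphicOn 𝒥 h S.U)
    {H : (Fin m → ℂ) → ℂ} (hH : ∀ p ∈ S.U, h p = H (S.map p)) :
    DifferentiableOn ℂ H S.image := by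
  rintro _ ⟨p, hp, rfl⟩
  obtain ⟨c, hc⟩ := S.hasFDerivAt_comp_symm hh (S.coord_mem hp)
  rw [← S.affineSection_map p] at hc
  refine DifferentiableAt.differentiableWithinAt
    ((hc.comp _ (S.hasFDerivAt_affineSection p _)).congr_of_eventuallyEq ?_).differentiableAt
  -- Near `S.map p`, `H` agrees with `h ∘ S.coord.symm ∘ S.affineSection p`.
  filter_upwards [S.eventually_affineSection_mem hp] with w hw
  rw [Function.comp_apply, Function.comp_apply, hH _ (S.symm_mem hw),
    S.map_symm_affineSection hp hw]

end LocalSpencerCoordinates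

end Spencer

theorem lemma2 {n m : ℕ} {M : Type*} [TopologicalSpace M] [ChartedSpace (Spencer.Model n) M]
    [IsManifold 𝓘(ℝ, Spencer.Model n) ∞ M] (𝒥 : Spencer.AlmostComplexStructure n M)
    (S : Spencer.LocalSpencerCoordinates 𝒥 m)
    (hleaf : ∀ w ∈ S.image, IsConnected (S.leaf w)) :
    IsOpen S.image ∧
      ∀ h : M → ℂ, Spencer.AlmostHolomorphicOn 𝒥 h S.U →
        ∃ H : (Fin m → ℂ) → ℂ, DifferentiableOn ℂ H S.image ∧
          ∀ p ∈ S.U, h p = H (S.map p) := by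
  refine ⟨S.isOpen_image, fun h hh ↦ ?_⟩
  obtain ⟨H, hH⟩ : ∃ H : (Fin m → ℂ) → ℂ, ∀ p ∈ S.U, h p = H (S.map p) := by
    have hex : ∀ w : Fin m → ℂ, ∃ z : ℂ, ∀ p ∈ S.U, S.map p = w → h p = z := by
      intro w
      by_cases hw : w ∈ S.image
      · obtain ⟨q, hq, rfl⟩ := hw
        exact ⟨h q, fun p hp hpq ↦ S.eq_of_map_eq hh hp hq hpq
          (hleaf _ ⟨q, hq, rfl⟩).isPreconnected⟩
      -- Off the image the fibre is empty and the value 0 is arbitrary.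
      · exact ⟨0, fun p hp hpw ↦ (hw ⟨p, hp, hpw⟩).elim⟩
    choose H hH using hex
    exact ⟨H, fun p hp ↦ hH _ p hp rfl⟩
  exact ⟨H, S.differentiableOn_of_eq_comp hh hH, hH⟩
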